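/- All graphs are finite and simple. Let $G$ be a graph with vertex set $N_G$ and edge set $E_G$, let $\lambda\colon E_G\to\mathbb{Z}_{>0}$ be an edge labeling, and for $k\ge 1$ let $\pi_k$, $\pi_{\le k}$, $\pi_{<k}$ be the sets of edges of label $k$, at most $k$, and less than $k$. The pair $(G,\lambda)$ is an *MAT-labeled graph* if for every $k\ge 1$: (1) no edge $e\in\pi_{\le k}$ forms a cycle with edges in $\pi_k$; (2) every edge $e\in\pi_k$ forms exactly $k-1$ triangles with edges in $\pi_{<k}$. For $e=\{i,j\}\in\pi_k$, the *conditioning vertices* of $e$ are the vertices $h$ such that $\{i,h\}$ and $\{j,h\}$ are both in $\pi_{<k}$, and the *principal clique* $K_e$ generated by $e$ is the set consisting of $i$, $j$ and the conditioning vertices of $e$. A finite poset $\mathcal{P}$ is *graded* with rank function $\operatorname{rk}\colon\mathcal{P}\to\mathbb{Z}_{\ge 0}$ if $x<y$ implies $\operatorname{rk}(x)<\operatorname{rk}(y)$, if $\operatorname{rk}(x)=\operatorname{rk}(y)-1$ whenever $y$ covers $x$, and if all minimal elements have rank $1$. Its *rank* $\operatorname{rk}(\mathcal{P})$ is the largest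 rank of an element ($0$ if $\mathcal{P}$ is empty), and its *dimension* $\dim(\mathcal{P})$ is the number of minimal elements. A finite graded poset $\mathcal{P}$ is a *vine* if * every non-minimal node covers exactly two other nodes, and any two distinct nodes of the same rank are covered by at most one node; and * for each $1\le i\le\operatorname{rk}(\mathcal{P})$ the graph $F_i$, whose nodes are the elements of rank $i$ and whose edges are the sets of elements covered by $v$, for $v$ of rank $i+1$, is a forest. A vine $\mathcal{P}$ is an *R-vine* if $\operatorname{rk}(\mathcal{P})=\dim(\mathcal{P})$, each $F_i$ with $1\le i\le\operatorname{rk}(\mathcal{P})$ is a tree, and any two distinct nodes of the same rank $i\ge 2$ that are covered by a common node also cover a common node. A vine is an *LR-vine* if each of its principal ideals $\{x\in\mathcal{P}\mid x\le a\}$, $a\in\mathcal{P}$, with the induced order and rank function, is an R-vine. **Theorem.** Let $(G,\lambda)$ be an MAT-labeled graph. Let $\mathcal{P}$ be the set consisting of the singletons $\{v\}$, $v\in N_G$, and the principal cliques $K_e$, $e\in E_G$, ordered by inclusion, with $\operatorname{rk}(S)=|S|$ for $S\in\mathcal{P}$. Then $\mathcal{P}$, with this rank function, is an LR-vine. If moreover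 $G$ is a complete graph, then $\mathcal{P}$ is an R-vine. -/

import Mathlib

namespace MATVine

/-! ### MAT-labeled graphs -/

section Graphs

/-- The set `π_k` of edges of label `k`, as a set of unordered pairs of vertices. -/
def edgesOfLabel {V : Type*} (G : SimpleGraph V) (lam : G.edgeSet → ℕ+) (k : ℕ+) :
    Set (Sym2 V) :=
  {e | ∃ h : e ∈ G.edgeSet, lam ⟨e, h⟩ = k}

/-- The set `π_{≤ k}` of edges of label at most `k`. -/
def edgesOfLabelLE {V : Type*} (G : SimpleGraph V) (lam : G.edgeSet → ℕ+) (k : ℕ+) :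
    Set (Sym2 V) :=
  {e | ∃ h : e ∈ G.edgeSet, lam ⟨e, h⟩ ≤ k}

/-- The set `π_{< k}` of edges of label smaller than `k`. -/
def edgesOfLabelLT {V : Type*} (G : SimpleGraph V) (lam : G.edgeSet → ℕ+) (k : ℕ+) :
    Set (Sym2 V) :=
  {e | ∃ h : e ∈ G.edgeSet, lam ⟨e, h⟩ < k}

/-- `e` forms a cycle with edges in `S`: some cycle passes through `e` and all its edges
belong to `S ∪ {e}`. -/
def FormsCycleWith {V : Type*} (e : Sym2 V) (S : Set (Sym2 V)) : Prop :=
  ∃ (v : V) (c : (SimpleGraph.fromEdgeSet (insert e S)).Walk v v), c.IsCycle ∧ e ∈ c.edges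

/-- The conditioning vertices of an edge `e` of label `k`: the vertices which together with the
endvertices of `e` form two edges both of label smaller than `k`. They correspond to the triangles
formed by `e` and two edges in `π_{< k}`. -/
def conditioningVertices {V : Type*} (G : SimpleGraph V) (lam : G.edgeSet → ℕ+)
    (e : G.edgeSet) : Set V :=
  {h | ∀ v ∈ (e : Sym2 V), s(v, h) ∈ edgesOfLabelLT G lam (lam e)}

/-- MAT-labelings of a graph. -/
structure IsMATLabeling {V : Type*} (G : SimpleGraph V) (lam : G.edgeSet → ℕ+) : Prop where
  /-- An edge in `π_{≤ k}` does not form a cycle with edges in `π_k`. -/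
  no_cycle : ∀ k : ℕ+, ∀ e ∈ edgesOfLabelLE G lam k, ¬ FormsCycleWith e (edgesOfLabel G lam k)
  /-- An edge of label `k` forms exactly `k - 1` triangles with edges in `π_{< k}`. -/
  triangles : ∀ e : G.edgeSet, (conditioningVertices G lam e).ncard = (lam e : ℕ) - 1

/-- The principal clique `K_e`: the endvertices of `e` and the conditioning vertices of `e`. -/
def principalClique {V : Type*} (G : SimpleGraph V) (lam : G.edgeSet → ℕ+) (e : G.edgeSet) :
    Set V :=
  {v | v ∈ (e : Sym2 V)} ∪ conditioningVertices G lam e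

/-- The collection of all singletons and all principal cliques. As a type it is partially ordered
by inclusion. -/
def cliquePoset {V : Type*} (G : SimpleGraph V) (lam : G.edgeSet → ℕ+) : Set (Set V) :=
  {S | (∃ v : V, S = {v}) ∨ ∃ e : G.edgeSet, S = principalClique G lam e}

/-- The rank function of `cliquePoset`: cardinality. -/
noncomputable def cliqueRank {V : Type*} (G : SimpleGraph V) (lam : G.edgeSet → ℕ+)
    (S : cliquePoset G lam) : ℕ :=
  (S : Set V).ncard

end Graphs

/-! ### Vines as graded posets -/

section Posets

/-- `P` is graded with rank function `rk`, minimal elements having rank `1`. -/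
structure IsGradedBy (P : Type*) [PartialOrder P] (rk : P → ℕ) : Prop where
  strict : ∀ x y : P, x < y → rk x < rk y
  cover : ∀ x y : P, x ⋖ y → rk y = rk x + 1
  minimal : ∀ x : P, IsMin x → rk x = 1

/-- The dimension of a poset: the number of minimal elements. -/
noncomputable def posetDim (P : Type*) [PartialOrder P] : ℕ :=
  {x : P | IsMin x}.ncard

/-- The rank of a finite poset with rank function `rk`: the largest rank of an element. -/
noncomputable def posetRank {P : Type*} (rk : P → ℕ) : ℕ :=
  ⨆ x : P, rk x

/-- The set of elements covered by `v`. -/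
def coveredBy {P : Type*} [PartialOrder P] (v : P) : Set P :=
  {x | x ⋖ v}

/-- The `i`-th associated graph `F_i`: its nodes are the elements of rank `i`, its edges are the
sets of elements covered by the elements of rank `i + 1`. -/
def associatedGraph {P : Type*} [PartialOrder P] (rk : P → ℕ) (i : ℕ) :
    SimpleGraph {x : P // rk x = i} where
  Adj a b := a ≠ b ∧ ∃ v : P, rk v = i + 1 ∧ coveredBy v = {a.1, b.1}
  symm := ⟨fun _ _ h => ⟨h.1.symm, h.2.imp fun _ hv => ⟨hv.1, hv.2.trans (Set.pair_comm _ _)⟩⟩⟩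
  loopless := ⟨fun _ h => h.1 rfl⟩

/-- A vine: a finite graded poset in which every non-minimal node covers exactly two nodes, two
distinct nodes of the same rank are covered by at most one node, and all associated graphs are
forests. -/
structure IsVine (P : Type*) [PartialOrder P] (rk : P → ℕ) : Prop where
  finite : Finite P
  graded : IsGradedBy P rk
  covers_two : ∀ v : P, ¬ IsMin v → (coveredBy v).ncard = 2
  covered_unique : ∀ a b : P, a ≠ b → rk a = rk b →
    ∀ v w : P, a ⋖ v → b ⋖ v → a ⋖ w → b ⋖ w → v = w
  forest : ∀ i : ℕ, 1 ≤ i → i ≤ posetRank rk → (associatedGraph rk i).IsAcyclic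

/-- A regular vine. -/
structure IsRVine (P : Type*) [PartialOrder P] (rk : P → ℕ) : Prop where
  vine : IsVine P rk
  rank_eq_dim : posetRank rk = posetDim P
  tree : ∀ i : ℕ, 1 ≤ i → i ≤ posetRank rk → (associatedGraph rk i).IsTree
  proximity : ∀ i : ℕ, 2 ≤ i → ∀ a b : P, a ≠ b → rk a = i → rk b = i →
    (∃ v : P, a ⋖ v ∧ b ⋖ v) → ∃ u : P, u ⋖ a ∧ u ⋖ b

/-- A locally regular vine: a vine all of whose principal ideals, with the induced order and the
restricted rank function, are regular vines. -/
structure IsLRVine (P : Type*) [PartialOrder P] (rk : P → ℕ) : Prop where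
  vine : IsVine P rk
  locally_regular : ∀ a : P, IsRVine (Set.Iic a) (fun x : Set.Iic a => rk x.1)

end Posets

end MATVine

namespace MATVine

variable {V : Type*} {G : SimpleGraph V} {lam : G.edgeSet → ℕ+}

/-! ### Edges by label -/

/-! The core is a separation statement, `separatesAt`: for an edge `ij` of label `k` with
conditioning set `C`, once `C` and the edge `ij` are deleted, edges of label at most `k` no longer
connect `i` to `j`. It is proved by strong induction on `k`. Separation at smaller labels gives
every four-cycle of labels below `k` a chord of label below `k`, so `C` is a clique with labels
below `k`. It also shows that `C` separates any two vertices joined to all of it by labels below `k`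
(`not_reachable_of_clique`). A connection from `i` to `j` avoiding `C` can therefore be compressed
to a connection by label-`k` edges alone, which the acyclicity condition forbids.

The poset then has an intrinsic description (`mem_cliquePoset_iff`): its elements are the nonempty
cliques whose labels are all smaller than their size. A counting bound, `ncard_le_of_forall_LE`,
forces such a clique of size `k + 1` to be `{i, j} ∪ C` for an edge `ij` of label `k` with
conditioning set `C`. It covers exactly `{i} ∪ C` and `{j} ∪ C`, and these both cover `C` when `k >
1`, which is proximity. Walks in `F_k` project to walks in `G`, so separation makes each edge of
`F_k` a bridge.

For regularity, proximity connects elements of equal rank below a common element, so every `F_i`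
with `i` at most the rank is a tree as soon as there is a greatest element. Principal ideals have
one, and for a nonempty complete graph the whole vertex set is one. -/

theorem mem_edgesOfLabel_lt_or_eq {k : ℕ+} {e : Sym2 V} (h : e ∈ edgesOfLabelLE G lam k) :
    e ∈ edgesOfLabelLT G lam k ∨ e ∈ edgesOfLabel G lam k :=
  h.elim fun he hk => hk.lt_or_eq.imp (fun h => ⟨he, h⟩) fun h => ⟨he, h⟩

theorem edgesOfLabelLT_subset_LE {k : ℕ+} : edgesOfLabelLT G lam k ⊆ edgesOfLabelLE G lam k :=
  fun _ h => h.imp fun _ => le_of_lt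

theorem edgesOfLabel_subset_LE {k : ℕ+} : edgesOfLabel G lam k ⊆ edgesOfLabelLE G lam k :=
  fun _ h => h.imp fun _ => le_of_eq

theorem edgesOfLabelLT_mono {k l : ℕ+} (hkl : k ≤ l) :
    edgesOfLabelLT G lam k ⊆ edgesOfLabelLT G lam l :=
  fun _ h => h.imp fun _ h => h.trans_le hkl

theorem edgesOfLabelLE_subset_LT {k l : ℕ+} (hkl : k < l) :
    edgesOfLabelLE G lam k ⊆ edgesOfLabelLT G lam l :=
  fun _ h => h.imp fun _ h => h.trans_lt hkl

theorem edgesOfLabelLT_subset_LE_of_le_add_one {k l : ℕ+} (hkl : (k : ℕ) ≤ l + 1) :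
    edgesOfLabelLT G lam k ⊆ edgesOfLabelLE G lam l := by
  rintro e ⟨he, hk⟩
  refine ⟨he, ?_⟩
  rw [← PNat.coe_lt_coe] at hk
  rw [← PNat.coe_le_coe]
  omega

theorem notMem_edgesOfLabel_of_LT {k : ℕ+} {e : Sym2 V} (h : e ∈ edgesOfLabelLT G lam k) :
    e ∉ edgesOfLabel G lam k := by
  rintro ⟨he, rfl⟩
  exact lt_irrefl _ h.2

theorem ne_of_mem_LE {k : ℕ+} {a b : V} (h : s(a, b) ∈ edgesOfLabelLE G lam k) : a ≠ b :=
  G.ne_of_adj h.1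

theorem ne_of_mem_LT {k : ℕ+} {a b : V} (h : s(a, b) ∈ edgesOfLabelLT G lam k) : a ≠ b :=
  G.ne_of_adj h.1

theorem ne_of_mem_edgesOfLabel {k : ℕ+} {a b : V} (h : s(a, b) ∈ edgesOfLabel G lam k) : a ≠ b :=
  G.ne_of_adj h.1

/-- The vertices joined to both `a` and `b` by edges of label smaller than `k`. -/
def commonNbrs (G : SimpleGraph V) (lam : G.edgeSet → ℕ+) (k : ℕ+) (a b : V) : Set V :=
  {h | s(a, h) ∈ edgesOfLabelLT G lam k ∧ s(b, h) ∈ edgesOfLabelLT G lam k}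

theorem commonNbrs_comm (k : ℕ+) (a b : V) : commonNbrs G lam k a b = commonNbrs G lam k b a :=
  Set.ext fun _ => and_comm

theorem left_notMem_commonNbrs {k : ℕ+} {a b : V} : a ∉ commonNbrs G lam k a b :=
  fun h => ne_of_mem_LT h.1 rfl

theorem right_notMem_commonNbrs {k : ℕ+} {a b : V} : b ∉ commonNbrs G lam k a b :=
  fun h => ne_of_mem_LT h.2 rfl

theorem conditioningVertices_eq {a b : V} {k : ℕ+} (hab : s(a, b) ∈ G.edgeSet)
    (hk : lam ⟨s(a, b), hab⟩ = k) :
    conditioningVertices G lam ⟨s(a, b), hab⟩ = commonNbrs G lam k a b := by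
  subst hk
  ext h
  simp [conditioningVertices, commonNbrs]

theorem principalClique_eq {a b : V} {k : ℕ+} (hab : s(a, b) ∈ G.edgeSet)
    (hk : lam ⟨s(a, b), hab⟩ = k) :
    principalClique G lam ⟨s(a, b), hab⟩ = insert a (insert b (commonNbrs G lam k a b)) := by
  ext h
  simp [principalClique, conditioningVertices_eq hab hk, or_assoc]

/-! ### Consequences of the defining conditions -/

theorem ncard_commonNbrs (hlam : IsMATLabeling G lam) {k : ℕ+} {a b : V}
    (hab : s(a, b) ∈ edgesOfLabel G lam k) : (commonNbrs G lam k a b).ncard + 1 = k := by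
  obtain ⟨h, hk⟩ := hab
  have := hlam.triangles ⟨s(a, b), h⟩
  rw [conditioningVertices_eq h hk, hk] at this
  have := k.pos
  omega

/-- The endvertices of an edge of label at most `k` are not joined by other edges of label `k`. -/
theorem not_reachable_edgesOfLabel (hlam : IsMATLabeling G lam) {k : ℕ+} {a b : V}
    (hab : s(a, b) ∈ edgesOfLabelLE G lam k) :
    ¬ (SimpleGraph.fromEdgeSet (edgesOfLabel G lam k \ {s(a, b)})).Reachable a b := by
  intro h
  refine hlam.no_cycle k _ hab ?_
  refine SimpleGraph.adj_and_reachable_delete_edges_iff_exists_cycle.1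
    ⟨by simp [ne_of_mem_LE hab], h.mono ?_⟩
  intro x y hxy
  simp only [SimpleGraph.fromEdgeSet_adj, SimpleGraph.deleteEdges_adj, Set.mem_sdiff,
    Set.mem_singleton_iff, Set.mem_insert_iff] at hxy ⊢
  tauto

/-- In a triangle whose largest label is `k`, only one edge has label `k`. -/
theorem mem_commonNbrs_of_LE (hlam : IsMATLabeling G lam) {k : ℕ+} {a b c : V}
    (hab : s(a, b) ∈ edgesOfLabel G lam k) (hca : s(a, c) ∈ edgesOfLabelLE G lam k)
    (hcb : s(b, c) ∈ edgesOfLabelLE G lam k) : c ∈ commonNbrs G lam k a b := by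
  have key : ∀ {a b : V}, s(a, b) ∈ edgesOfLabel G lam k → s(a, c) ∈ edgesOfLabelLE G lam k →
      s(b, c) ∈ edgesOfLabelLE G lam k → s(a, c) ∈ edgesOfLabelLT G lam k := by
    intro a b hab hca hcb
    refine (mem_edgesOfLabel_lt_or_eq hca).resolve_right fun h => ?_
    have hne := ne_of_mem_edgesOfLabel hab
    have hne' := ne_of_mem_LE hca
    have hne'' := ne_of_mem_LE hcb
    -- If `ac` also had label `k`, the path `b, a, c` would join the ends of `bc` by label-`k` edges
    -- other than `bc`.
    refine not_reachable_edgesOfLabel hlam hcb (SimpleGraph.Reachable.trans (v := a)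
      (SimpleGraph.Adj.reachable ?_) (SimpleGraph.Adj.reachable ?_))
    · rw [SimpleGraph.fromEdgeSet_adj]
      refine ⟨⟨by rwa [Sym2.eq_swap], ?_⟩, hne.symm⟩
      simp; grind
    · rw [SimpleGraph.fromEdgeSet_adj]
      refine ⟨⟨h, ?_⟩, hne'⟩
      simp; grind
  exact ⟨key hab hca hcb, key (by rwa [Sym2.eq_swap]) hcb hca⟩

/-- A set of vertices all joined to both ends of an edge of label `k` by edges of label at most
`k` has at most `k + 1` elements. -/
theorem ncard_le_of_forall_LE [Finite V] (hlam : IsMATLabeling G lam) {k : ℕ+} {a b : V}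
    (hab : s(a, b) ∈ edgesOfLabel G lam k) {D : Set V}
    (hD : ∀ d ∈ D, d ≠ a → d ≠ b →
      s(a, d) ∈ edgesOfLabelLE G lam k ∧ s(b, d) ∈ edgesOfLabelLE G lam k) :
    D.ncard ≤ k + 1 := by
  have h1 : D ⊆ insert a (insert b (commonNbrs G lam k a b)) := by
    intro d hd
    by_cases ha : d = a
    · simp [ha]
    by_cases hb : d = b
    · simp [hb]
    · exact Or.inr (Or.inr (mem_commonNbrs_of_LE hlam hab (hD d hd ha hb).1 (hD d hd ha hb).2))
  -- The bound is two endvertices plus `k - 1` conditioning vertices.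
  have h2 := Set.ncard_le_ncard h1 (Set.toFinite _)
  have h3 := ncard_commonNbrs hlam hab
  have h4 := Set.ncard_insert_le a (insert b (commonNbrs G lam k a b))
  have h5 := Set.ncard_insert_le b (commonNbrs G lam k a b)
  omega

/-- A nontrivial clique with labels less than `k` has an edge of largest label. -/
theorem exists_max_label [Finite V] {k : ℕ+} {K : Set V} (hK : K.Nontrivial)
    (hlt : K.Pairwise fun a b => s(a, b) ∈ edgesOfLabelLT G lam k) :
    ∃ l < k, ∃ a ∈ K, ∃ b ∈ K, s(a, b) ∈ edgesOfLabel G lam l ∧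
      K.Pairwise fun a b => s(a, b) ∈ edgesOfLabelLE G lam l := by
  obtain ⟨x, hx, y, hy, hxy⟩ := hK
  obtain ⟨⟨e, he⟩, heK, hmax⟩ := Set.exists_max_image {e : G.edgeSet | ∀ v ∈ (e : Sym2 V), v ∈ K}
    lam (Set.toFinite _) ⟨⟨s(x, y), (hlt hx hy hxy).1⟩, by simp [hx, hy]⟩
  induction e using Sym2.ind with
  | _ a b =>
    simp only [Set.mem_ofPred_eq, Sym2.mem_iff, forall_eq_or_imp, forall_eq] at heK
    refine ⟨lam ⟨s(a, b), he⟩, (hlt heK.1 heK.2 (G.ne_of_adj he)).2, a, heK.1, b, heK.2,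
      ⟨he, rfl⟩, fun c hc d hd hcd => ⟨(hlt hc hd hcd).1, hmax ⟨s(c, d), _⟩ ?_⟩⟩
    simp [hc, hd]

/-- A clique of size `k` with labels less than `k` has an edge of label `k - 1`. -/
theorem exists_edge_label_pred [Finite V] (hlam : IsMATLabeling G lam) {k : ℕ+} {K : Set V}
    (hK : K.Nontrivial) (hlt : K.Pairwise fun a b => s(a, b) ∈ edgesOfLabelLT G lam k)
    (hcard : (k : ℕ) ≤ K.ncard) :
    ∃ l : ℕ+, (l : ℕ) + 1 = k ∧ K.ncard = k ∧ ∃ a ∈ K, ∃ b ∈ K, s(a, b) ∈ edgesOfLabel G lam l ∧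
      K.Pairwise fun a b => s(a, b) ∈ edgesOfLabelLE G lam l := by
  obtain ⟨l, hl, a, ha, b, hb, hab, hle⟩ := exists_max_label hK hlt
  -- With largest label `l`, the whole clique has at most `l + 1` vertices; as it has at least `k >
  -- l`, both inequalities are tight.
  have h := ncard_le_of_forall_LE hlam hab (D := K)
    fun d hd hda hdb => ⟨hle ha hd hda.symm, hle hb hd hdb.symm⟩
  rw [← PNat.coe_lt_coe] at hl
  exact ⟨l, by omega, by omega, a, ha, b, hb, hab, hle⟩

/-! ### Separation by conditioning vertices -/

/-- The graph with edge set `E` after deletion of the vertices in `C`. -/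
def graphAvoiding (E : Set (Sym2 V)) (C : Set V) : SimpleGraph V :=
  SimpleGraph.fromEdgeSet {e ∈ E | ∀ v ∈ e, v ∉ C}

theorem graphAvoiding_adj {E : Set (Sym2 V)} {C : Set V} {a b : V} :
    (graphAvoiding E C).Adj a b ↔ s(a, b) ∈ E ∧ a ∉ C ∧ b ∉ C ∧ a ≠ b := by
  simp [graphAvoiding, and_assoc]

/-- Each edge of label `k` is the only connection between its ends by edges of label at most `k`
once its conditioning vertices are deleted. -/
def SeparatesAt (G : SimpleGraph V) (lam : G.edgeSet → ℕ+) (k : ℕ+) : Prop :=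
  ∀ i j : V, s(i, j) ∈ edgesOfLabel G lam k →
    ¬ (graphAvoiding (edgesOfLabelLE G lam k \ {s(i, j)}) (commonNbrs G lam k i j)).Reachable i j

/-- Without the chord, neither `h'` nor `j` is a conditioning vertex of `ih`, so the rest of the
four-cycle, `i, h', j, h`, would bypass the edge `ih`. -/
theorem SeparatesAt.mem_commonNbrs {l : ℕ+} (hl : SeparatesAt G lam l) {i j h h' : V}
    (hij : s(i, j) ∉ edgesOfLabelLT G lam l) (hne : i ≠ j) (hne' : h ≠ h')
    (hih : s(i, h) ∈ edgesOfLabel G lam l) (hih' : s(i, h') ∈ edgesOfLabelLE G lam l)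
    (hjh : s(j, h) ∈ edgesOfLabelLE G lam l) (hjh' : s(j, h') ∈ edgesOfLabelLE G lam l) :
    s(h, h') ∈ edgesOfLabelLT G lam l := by
  by_contra hc
  have h1 : h' ∉ commonNbrs G lam l i h := fun h => hc h.2
  have h2 : j ∉ commonNbrs G lam l i h := fun h => hij h.1
  have n1 := ne_of_mem_LE hih'
  have n2 := ne_of_mem_LE hjh
  have n3 := ne_of_mem_LE hjh'
  refine hl i h hih (((SimpleGraph.Adj.reachable (v := h') ?_).trans
    (SimpleGraph.Adj.reachable (v := j) ?_)).trans (SimpleGraph.Adj.reachable ?_))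
  · refine graphAvoiding_adj.2 ⟨⟨hih', ?_⟩, left_notMem_commonNbrs, h1, n1⟩
    simp; grind
  · refine graphAvoiding_adj.2 ⟨⟨by rwa [Sym2.eq_swap], ?_⟩, h1, h2, n3.symm⟩
    simp; grind
  · refine graphAvoiding_adj.2 ⟨⟨hjh, ?_⟩, h2, right_notMem_commonNbrs, n2⟩
    simp; grind

/-- A four-cycle has a chord. -/
theorem mem_LT_of_four_cycle {k : ℕ+} (hsep : ∀ l < k, SeparatesAt G lam l) {i j h h' : V}
    (hij : s(i, j) ∉ edgesOfLabelLT G lam k) (hne : i ≠ j) (hne' : h ≠ h')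
    (hih : s(i, h) ∈ edgesOfLabelLT G lam k) (hih' : s(i, h') ∈ edgesOfLabelLT G lam k)
    (hjh : s(j, h) ∈ edgesOfLabelLT G lam k) (hjh' : s(j, h') ∈ edgesOfLabelLT G lam k) :
    s(h, h') ∈ edgesOfLabelLT G lam k := by
  -- This is the case where `ih` carries the largest label of the four-cycle; the case split below
  -- reduces to it by swapping `i` with `j` and `h` with `h'`.
  have key : ∀ {i j h h' : V}, s(i, j) ∉ edgesOfLabelLT G lam k → i ≠ j → h ≠ h' →
      ∀ (h1 : s(i, h) ∈ edgesOfLabelLT G lam k) (h2 : s(i, h') ∈ edgesOfLabelLT G lam k)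
        (h3 : s(j, h) ∈ edgesOfLabelLT G lam k) (h4 : s(j, h') ∈ edgesOfLabelLT G lam k),
        lam ⟨_, h2.1⟩ ≤ lam ⟨_, h1.1⟩ → lam ⟨_, h3.1⟩ ≤ lam ⟨_, h1.1⟩ →
        lam ⟨_, h4.1⟩ ≤ lam ⟨_, h1.1⟩ → s(h, h') ∈ edgesOfLabelLT G lam k := by
    intro i j h h' hij hne hne' h1 h2 h3 h4 l2 l3 l4
    exact edgesOfLabelLT_mono h1.2.le ((hsep _ h1.2).mem_commonNbrs
      (fun h => hij (edgesOfLabelLT_mono h1.2.le h)) hne hne' ⟨h1.1, rfl⟩ ⟨h2.1, l2⟩ ⟨h3.1, l3⟩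
      ⟨h4.1, l4⟩)
  have hji : s(j, i) ∉ edgesOfLabelLT G lam k := by rwa [Sym2.eq_swap]
  rcases le_total (lam ⟨_, hih.1⟩) (lam ⟨_, hih'.1⟩) with l1 | l1 <;>
  rcases le_total (lam ⟨_, hjh.1⟩) (lam ⟨_, hjh'.1⟩) with l2 | l2
  · rw [Sym2.eq_swap]
    rcases le_total (lam ⟨_, hih'.1⟩) (lam ⟨_, hjh'.1⟩) with l3 | l3
    · exact key hji hne.symm hne'.symm hjh' hjh hih' hih l2 l3 (l1.trans l3)
    · exact key hij hne hne'.symm hih' hih hjh' hjh l1 l3 (l2.trans l3)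
  · rcases le_total (lam ⟨_, hih'.1⟩) (lam ⟨_, hjh.1⟩) with l3 | l3
    · exact key hji hne.symm hne' hjh hjh' hih hih' l2 (l1.trans l3) l3
    · rw [Sym2.eq_swap]
      exact key hij hne hne'.symm hih' hih hjh' hjh l1 (l2.trans l3) l3
  · rcases le_total (lam ⟨_, hih.1⟩) (lam ⟨_, hjh'.1⟩) with l3 | l3
    · rw [Sym2.eq_swap]
      exact key hji hne.symm hne'.symm hjh' hjh hih' hih l2 (l1.trans l3) l3
    · exact key hij hne hne' hih hih' hjh hjh' l1 (l2.trans l3) l3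
  · rcases le_total (lam ⟨_, hih.1⟩) (lam ⟨_, hjh.1⟩) with l3 | l3
    · exact key hji hne.symm hne' hjh hjh' hih hih' l2 l3 (l1.trans l3)
    · exact key hij hne hne' hih hih' hjh hjh' l1 l3 (l2.trans l3)

/-- Two conditioning vertices `a`, `b` form with `i`, `j` a four-cycle of labels below `k`. The
diagonal `ij` has label exactly `k`, so the chord must be `ab`. -/
theorem pairwise_commonNbrs {k : ℕ+} (hsep : ∀ l < k, SeparatesAt G lam l) {i j : V}
    (hij : s(i, j) ∈ edgesOfLabel G lam k) :
    (commonNbrs G lam k i j).Pairwise fun a b => s(a, b) ∈ edgesOfLabelLT G lam k :=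
  fun _ ha _ hb hab => mem_LT_of_four_cycle hsep
    (fun h => notMem_edgesOfLabel_of_LT h hij) (ne_of_mem_edgesOfLabel hij) hab ha.1 hb.1 ha.2 hb.2

theorem pairwise_insert_of_forall_LT {k : ℕ+} {C : Set V} {x : V}
    (hC : C.Pairwise fun a b => s(a, b) ∈ edgesOfLabelLT G lam k)
    (hx : ∀ c ∈ C, s(x, c) ∈ edgesOfLabelLT G lam k) :
    (insert x C).Pairwise fun a b => s(a, b) ∈ edgesOfLabelLT G lam k :=
  Set.pairwise_insert.2
    ⟨hC, fun c hc _ => ⟨hx c hc, by rw [Sym2.eq_swap]; exact hx c hc⟩⟩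

/-- If `C` is a clique of size `k - 1` with labels less than `k`, then any two vertices joined to
all of `C` are separated by `C` in the graph of edges of label less than `k`. -/
theorem not_reachable_of_clique [Finite V] (hlam : IsMATLabeling G lam) {k : ℕ+}
    (hsep : ∀ l < k, SeparatesAt G lam l) {C : Set V}
    (hC : C.Pairwise fun a b => s(a, b) ∈ edgesOfLabelLT G lam k) (hcard : C.ncard + 1 = k)
    {x y : V} (hx : ∀ c ∈ C, s(x, c) ∈ edgesOfLabelLT G lam k)
    (hy : ∀ c ∈ C, s(y, c) ∈ edgesOfLabelLT G lam k) (hxy : x ≠ y) :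
    ¬ (graphAvoiding (edgesOfLabelLT G lam k) C).Reachable x y := by
  intro hr
  have hxC : x ∉ C := fun h => ne_of_mem_LT (hx x h) rfl
  have hyC : y ∉ C := fun h => ne_of_mem_LT (hy y h) rfl
  -- If `C` is empty then `k = 1`, and no edge has label below `1`.
  rcases C.eq_empty_or_nonempty with rfl | ⟨c, hc⟩
  · have hk : k = 1 := by simpa using hcard.symm
    subst hk
    obtain ⟨p⟩ := hr
    cases p with
    | nil => exact hxy rfl
    | cons h _ => exact not_lt_one (graphAvoiding_adj.1 h).1.2
  -- The clique `C ∪ {x}` has size `k`, so it contains an edge of label `l = k - 1`; each possible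
  -- position of that edge is refuted.
  have hK : (insert x C).ncard = k := by rw [Set.ncard_insert_of_notMem hxC, hcard]
  obtain ⟨l, hl, -, a, ha, b, hb, hab, hle⟩ := exists_edge_label_pred hlam
    (K := insert x C) ⟨x, by simp, c, by simp [hc], fun h => hxC (h ▸ hc)⟩
    (pairwise_insert_of_forall_LT hC hx) hK.ge
  have hsub : edgesOfLabelLT G lam k ⊆ edgesOfLabelLE G lam l :=
    edgesOfLabelLT_subset_LE_of_le_add_one hl.ge
  -- An edge `xh` of label `l` has conditioning set exactly `C \ {h}`, by counting. The given
  -- connection from `x` to `y`, followed by `yh`, then contradicts separation at `l`.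
  have key : ∀ h ∈ C, s(x, h) ∈ edgesOfLabel G lam l → False := by
    intro h hh hxh
    have h1 : C \ {h} ⊆ commonNbrs G lam l x h := fun d hd =>
      mem_commonNbrs_of_LE hlam hxh (hsub (hx d hd.1)) (hsub (hC hh hd.1 (Ne.symm hd.2)))
    have h2 : C \ {h} = commonNbrs G lam l x h := by
      refine Set.eq_of_subset_of_ncard_le h1 ?_ (Set.toFinite _)
      have := ncard_commonNbrs hlam hxh
      have := Set.ncard_sdiff_singleton_add_one hh
      omega
    have h3 : commonNbrs G lam l x h ⊆ C := h2 ▸ Set.sdiff_subset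
    refine hsep l (by rw [← PNat.coe_lt_coe]; omega) x h hxh
      ((hr.mono ?_).trans (SimpleGraph.Adj.reachable ?_))
    · intro u v huv
      rw [graphAvoiding_adj] at huv ⊢
      refine ⟨⟨hsub huv.1, ?_⟩, fun h => huv.2.1 (h3 h), fun h => huv.2.2.1 (h3 h), huv.2.2.2⟩
      simp; grind
    · rw [graphAvoiding_adj]
      refine ⟨⟨hsub (hy h hh), ?_⟩, fun h => hyC (h3 h), right_notMem_commonNbrs,
        ne_of_mem_LT (hy h hh)⟩
      simp; grind
  rcases ha with rfl | ha
  · rcases hb with rfl | hb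
    · exact ne_of_mem_edgesOfLabel hab rfl
    · exact key b hb hab
  rcases hb with rfl | hb
  · exact key a ha (by rwa [Sym2.eq_swap])
  -- If the edge lies inside `C`, all `k + 1` vertices of `C ∪ {x, y}` are joined to its ends by
  -- labels at most `l`, exceeding the bound `l + 1 = k`.
  have h1 := ncard_le_of_forall_LE hlam hab (D := insert y (insert x C)) ?_
  · rw [Set.ncard_insert_of_notMem (by simp [hxy.symm, hyC]), hK] at h1
    omega
  · rintro d (rfl | hd) hda hdb
    · exact ⟨hsub (by rw [Sym2.eq_swap]; exact hy a ha), hsub (by rw [Sym2.eq_swap]; exact hy b hb)⟩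
    · exact ⟨hle (Or.inr ha) hd hda.symm, hle (Or.inr hb) hd hdb.symm⟩

/-- The alleged connection is followed from `i` while remembering an anchor `w` joined to all of
`C`: label-`k` edges other than `ij` lead from `i` to `w`, and smaller labels lead from `w` to the
current vertex. At `j` the anchor has to be `j` itself, and a cycle of label-`k` edges through `ij`
appears. -/
theorem separatesAt [Finite V] (hlam : IsMATLabeling G lam) (k : ℕ+) : SeparatesAt G lam k := by
  induction k using PNat.strongInductionOn with
  | _ k hsep =>
  intro i j hij hr
  set C := commonNbrs G lam k i j
  have hC := pairwise_commonNbrs hsep hij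
  have hcard : C.ncard + 1 = k := ncard_commonNbrs hlam hij
  have key : ∀ z, (graphAvoiding (edgesOfLabelLE G lam k \ {s(i, j)}) C).Reachable i z →
      ∃ w, (∀ c ∈ C, s(w, c) ∈ edgesOfLabelLT G lam k) ∧
        (graphAvoiding (edgesOfLabelLT G lam k) C).Reachable w z ∧
        (SimpleGraph.fromEdgeSet (edgesOfLabel G lam k \ {s(i, j)})).Reachable i w := by
    intro z hz
    rw [SimpleGraph.reachable_iff_reflTransGen] at hz
    induction hz with
    | refl => exact ⟨i, fun c hc => hc.1, .rfl, .rfl⟩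
    | @tail u v _ huv ih =>
      obtain ⟨w, hw, hwu, hiw⟩ := ih
      obtain ⟨⟨huv, hne⟩, hu, hv, hne'⟩ := graphAvoiding_adj.1 huv
      rcases mem_edgesOfLabel_lt_or_eq huv with huv | huv
      · exact ⟨w, hw, hwu.trans (SimpleGraph.Adj.reachable
          (graphAvoiding_adj.2 ⟨huv, hu, hv, hne'⟩)), hiw⟩
      -- If the conditioning set of the label-`k` edge `uv` is `C`, then `u` is joined to all of
      -- `C`, hence is the anchor, and the anchor moves to `v`. Otherwise a conditioning vertex
      -- outside `C` gives a detour from `u` to `v` by smaller labels, and the anchor stays.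
      by_cases hsub : commonNbrs G lam k u v ⊆ C
      · have heq : commonNbrs G lam k u v = C := by
          refine Set.eq_of_subset_of_ncard_le hsub ?_ (Set.toFinite _)
          have := ncard_commonNbrs hlam huv
          omega
        have hwu' : w = u := by
          by_contra hne
          exact not_reachable_of_clique hlam hsep hC hcard hw
            (fun c hc => (heq ▸ hc : c ∈ commonNbrs G lam k u v).1) hne hwu
        subst hwu'
        exact ⟨v, fun c hc => (heq ▸ hc : c ∈ commonNbrs G lam k w v).2, .rfl,
          hiw.trans (SimpleGraph.Adj.reachable ((SimpleGraph.fromEdgeSet_adj _).2 ⟨⟨huv, hne⟩, hne'⟩))⟩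
      · obtain ⟨c, hc, hcC⟩ := Set.not_subset.1 hsub
        refine ⟨w, hw, hwu.trans ((SimpleGraph.Adj.reachable (v := c)
          (graphAvoiding_adj.2 ⟨hc.1, hu, hcC, ne_of_mem_LT hc.1⟩)).trans
          (SimpleGraph.Adj.reachable
          (graphAvoiding_adj.2 ⟨?_, hcC, hv, (ne_of_mem_LT hc.2).symm⟩))), hiw⟩
        rw [Sym2.eq_swap]
        exact hc.2
  obtain ⟨w, hw, hwj, hiw⟩ := key j hr
  have : w = j := by
    by_contra hne
    exact not_reachable_of_clique hlam hsep hC hcard hw (fun c hc => hc.2) hne hwj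
  subst this
  exact not_reachable_edgesOfLabel hlam (edgesOfLabel_subset_LE hij) hiw

/-! ### The clique poset -/

theorem singleton_mem_cliquePoset (v : V) : {v} ∈ cliquePoset G lam :=
  Or.inl ⟨v, rfl⟩

/-- Beyond singletons, `S` contains an edge of label `|S| - 1` that is maximal in `S`. All other
vertices of `S` condition it, and its principal clique has only `|S|` elements, so the two sets
agree. -/
theorem mem_cliquePoset_of_pairwise [Finite V] (hlam : IsMATLabeling G lam) {k : ℕ+} {S : Set V}
    (hcard : S.ncard = k) (hS : S.Pairwise fun a b => s(a, b) ∈ edgesOfLabelLT G lam k) :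
    S ∈ cliquePoset G lam := by
  rcases S.subsingleton_or_nontrivial with hs | hs
  · have hne : S.Nonempty := Set.nonempty_of_ncard_ne_zero (by have := k.pos; omega)
    obtain ⟨v, rfl⟩ := hs.eq_empty_or_singleton.resolve_left hne.ne_empty
    exact singleton_mem_cliquePoset v
  · obtain ⟨l, hl, -, a, ha, b, hb, hab, hle⟩ := exists_edge_label_pred hlam hs hS hcard.ge
    refine Or.inr ⟨⟨s(a, b), hab.1⟩, ?_⟩
    rw [principalClique_eq hab.1 hab.2]
    have hsub : S ⊆ insert a (insert b (commonNbrs G lam l a b)) := by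
      intro d hd
      by_cases hda : d = a
      · simp [hda]
      by_cases hdb : d = b
      · simp [hdb]
      exact Or.inr (Or.inr (mem_commonNbrs_of_LE hlam hab (hle ha hd (Ne.symm hda))
        (hle hb hd (Ne.symm hdb))))
    refine Set.eq_of_subset_of_ncard_le hsub ?_ (Set.toFinite _)
    have h1 := ncard_commonNbrs hlam hab
    have h2 := Set.ncard_insert_le a (insert b (commonNbrs G lam l a b))
    have h3 := Set.ncard_insert_le b (commonNbrs G lam l a b)
    omega

theorem ncard_principal [Finite V] (hlam : IsMATLabeling G lam) {k : ℕ+} {i j : V}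
    (hij : s(i, j) ∈ edgesOfLabel G lam k) :
    (insert i (insert j (commonNbrs G lam k i j))).ncard = k + 1 := by
  rw [Set.ncard_insert_of_notMem, Set.ncard_insert_of_notMem right_notMem_commonNbrs,
    ncard_commonNbrs hlam hij]
  simp [ne_of_mem_edgesOfLabel hij, left_notMem_commonNbrs]

/-- The singletons and principal cliques are the nonempty cliques in which all labels are smaller
than the size. -/
theorem mem_cliquePoset_iff [Finite V] (hlam : IsMATLabeling G lam) {S : Set V} :
    S ∈ cliquePoset G lam ↔
      ∃ k : ℕ+, S.ncard = k ∧ S.Pairwise fun a b => s(a, b) ∈ edgesOfLabelLT G lam k := by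
  refine ⟨?_, fun ⟨k, hk, hS⟩ => mem_cliquePoset_of_pairwise hlam hk hS⟩
  rintro (⟨v, rfl⟩ | ⟨⟨e, he⟩, rfl⟩)
  · exact ⟨1, by simp, Set.pairwise_singleton _ _⟩
  induction e using Sym2.ind with
  | _ i j =>
    rw [principalClique_eq he rfl]
    have hij : s(i, j) ∈ edgesOfLabel G lam (lam ⟨s(i, j), he⟩) := ⟨he, rfl⟩
    generalize lam ⟨s(i, j), he⟩ = k at hij
    have hk : k < k + 1 := PNat.lt_add_right k 1
    refine ⟨k + 1, by simp [ncard_principal hlam hij], ?_⟩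
    have hC := (pairwise_commonNbrs (fun l _ => separatesAt hlam l) hij).mono'
      fun a b h => edgesOfLabelLT_mono hk.le h
    refine pairwise_insert_of_forall_LT (pairwise_insert_of_forall_LT hC fun c hc =>
      edgesOfLabelLT_mono hk.le hc.2) ?_
    rintro c (rfl | hc)
    · exact edgesOfLabelLE_subset_LT hk (edgesOfLabel_subset_LE hij)
    · exact edgesOfLabelLT_mono hk.le hc.1

theorem pairwise_of_mem_cliquePoset [Finite V] (hlam : IsMATLabeling G lam) {S : Set V} {k : ℕ+}
    (hS : S ∈ cliquePoset G lam) (hk : S.ncard = k) :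
    S.Pairwise fun a b => s(a, b) ∈ edgesOfLabelLT G lam k := by
  obtain ⟨l, hl, h⟩ := (mem_cliquePoset_iff hlam).1 hS
  rwa [← PNat.coe_injective (hl.symm.trans hk)]

theorem nonempty_of_mem_cliquePoset {S : Set V} (hS : S ∈ cliquePoset G lam) : S.Nonempty := by
  obtain ⟨v, rfl⟩ | ⟨⟨e, he⟩, rfl⟩ := hS
  · exact Set.singleton_nonempty v
  · induction e using Sym2.ind with
    | _ i j => exact ⟨i, Or.inl (by simp)⟩

/-- A clique in the poset with at least two elements is `{i, j} ∪ C` with `ij` its only edge of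
largest label, `C` the conditioning vertices of `ij`; its facets are in the poset. -/
theorem exists_top_edge [Finite V] (hlam : IsMATLabeling G lam) {S : Set V} {k : ℕ+}
    (hS : S ∈ cliquePoset G lam) (hk : S.ncard = k + 1) :
    ∃ i j, s(i, j) ∈ edgesOfLabel G lam k ∧ S = insert i (insert j (commonNbrs G lam k i j)) ∧
      insert i (commonNbrs G lam k i j) ∈ cliquePoset G lam ∧
      insert j (commonNbrs G lam k i j) ∈ cliquePoset G lam := by
  have hS' := pairwise_of_mem_cliquePoset hlam (k := k + 1) hS (by simp [hk])
  have hnt : S.Nontrivial := by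
    have := k.pos
    rw [← Set.one_lt_ncard_iff_nontrivial]
    omega
  obtain ⟨l, hl, -, i, hi, j, hj, hij, hle⟩ := exists_edge_label_pred hlam hnt hS' (by simp [hk])
  obtain rfl : l = k := PNat.coe_injective (by simpa using hl)
  have hC := pairwise_commonNbrs (fun l _ => separatesAt hlam l) hij
  have hcard := ncard_commonNbrs hlam hij
  refine ⟨i, j, hij, ?_, ?_, ?_⟩
  · refine Set.eq_of_subset_of_ncard_le ?_ (by rw [ncard_principal hlam hij, hk]) (Set.toFinite _)
    intro d hd
    by_cases hda : d = i
    · simp [hda]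
    by_cases hdb : d = j
    · simp [hdb]
    exact Or.inr (Or.inr (mem_commonNbrs_of_LE hlam hij (hle hi hd (Ne.symm hda))
      (hle hj hd (Ne.symm hdb))))
  · refine mem_cliquePoset_of_pairwise hlam (k := l) ?_
      (pairwise_insert_of_forall_LT hC fun c hc => hc.1)
    rw [Set.ncard_insert_of_notMem left_notMem_commonNbrs, hcard]
  · refine mem_cliquePoset_of_pairwise hlam (k := l) ?_
      (pairwise_insert_of_forall_LT hC fun c hc => hc.2)
    rw [Set.ncard_insert_of_notMem right_notMem_commonNbrs, hcard]

/-- The conditioning vertices of an edge of label at least two form a clique in the poset. -/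
theorem commonNbrs_mem_cliquePoset [Finite V] (hlam : IsMATLabeling G lam) {i j : V} {k : ℕ+}
    (hij : s(i, j) ∈ edgesOfLabel G lam k) (hk : 1 < k) :
    commonNbrs G lam k i j ∈ cliquePoset G lam := by
  have hC := pairwise_commonNbrs (fun l _ => separatesAt hlam l) hij
  have hcard := ncard_commonNbrs hlam hij
  obtain ⟨c, hc⟩ : (commonNbrs G lam k i j).Nonempty :=
    Set.nonempty_of_ncard_ne_zero (by rw [← PNat.coe_lt_coe] at hk; simp at hk; omega)
  have hi : i ∉ commonNbrs G lam k i j := left_notMem_commonNbrs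
  have hj : j ∉ commonNbrs G lam k i j := right_notMem_commonNbrs
  have hcardi : (insert i (commonNbrs G lam k i j)).ncard = k := by
    rw [Set.ncard_insert_of_notMem hi, hcard]
  obtain ⟨l, hl, -, a, ha, b, hb, hab, hle⟩ := exists_edge_label_pred hlam
    (K := insert i (commonNbrs G lam k i j)) ⟨i, by simp, c, by simp [hc], fun h => hi (h ▸ hc)⟩
    (pairwise_insert_of_forall_LT hC fun c hc => hc.1) hcardi.ge
  refine mem_cliquePoset_of_pairwise hlam (k := l) (by omega) fun x hx y hy hxy => ?_
  refine (mem_edgesOfLabel_lt_or_eq (hle (Or.inr hx) (Or.inr hy) hxy)).resolve_right fun hxl => ?_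
  have hsub : edgesOfLabelLT G lam k ⊆ edgesOfLabelLE G lam l :=
    edgesOfLabelLT_subset_LE_of_le_add_one hl.ge
  -- An edge of label `l = k - 1` inside the conditioning set would have its ends joined to all `k +
  -- 1` vertices of the principal clique by labels at most `l`, which is one vertex too many.
  have h1 := ncard_le_of_forall_LE hlam hxl
    (D := insert j (insert i (commonNbrs G lam k i j))) ?_
  · rw [Set.ncard_insert_of_notMem (by simp [(ne_of_mem_edgesOfLabel hij).symm, hj]), hcardi] at h1
    omega
  · rintro d (rfl | hd) hda hdb
    · exact ⟨hsub (by rw [Sym2.eq_swap]; exact hx.2), hsub (by rw [Sym2.eq_swap]; exact hy.2)⟩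
    · exact ⟨hle (Or.inr hx) hd hda.symm, hle (Or.inr hy) hd hdb.symm⟩

/-- Labels inside `T` are below `|T| ≤ k`, whereas `ij` has label `k`; so `T` misses `i` or `j`. -/
theorem subset_insert_of_ssubset [Finite V] (hlam : IsMATLabeling G lam) {i j : V} {k : ℕ+}
    (hij : s(i, j) ∈ edgesOfLabel G lam k) {T : Set V} (hT : T ∈ cliquePoset G lam)
    (hTS : T ⊂ insert i (insert j (commonNbrs G lam k i j))) :
    T ⊆ insert i (commonNbrs G lam k i j) ∨ T ⊆ insert j (commonNbrs G lam k i j) := by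
  have hlt := Set.ncard_lt_ncard hTS (Set.toFinite _)
  rw [ncard_principal hlam hij] at hlt
  obtain ⟨l, hl, hT'⟩ := (mem_cliquePoset_iff hlam).1 hT
  by_cases hi : i ∈ T
  · by_cases hj : j ∈ T
    · refine absurd hij (notMem_edgesOfLabel_of_LT (edgesOfLabelLT_mono ?_
        (hT' hi hj (ne_of_mem_edgesOfLabel hij))))
      rw [← PNat.coe_le_coe]
      omega
    · left
      intro x hx
      have := hTS.1 hx
      have : x ≠ j := fun h => hj (h ▸ hx)
      simp_all
  · right
    intro x hx
    have := hTS.1 hx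
    have : x ≠ i := fun h => hi (h ▸ hx)
    simp_all

theorem coveredBy_eq [Finite V] (hlam : IsMATLabeling G lam) {S : cliquePoset G lam} {k : ℕ+}
    (hk : (S : Set V).ncard = k + 1) :
    ∃ i j, ∃ hi : insert i (commonNbrs G lam k i j) ∈ cliquePoset G lam,
      ∃ hj : insert j (commonNbrs G lam k i j) ∈ cliquePoset G lam,
      s(i, j) ∈ edgesOfLabel G lam k ∧ (⟨_, hi⟩ : cliquePoset G lam) ≠ ⟨_, hj⟩ ∧
      coveredBy S = {⟨_, hi⟩, ⟨_, hj⟩} := by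
  obtain ⟨S, hS⟩ := S
  obtain ⟨i, j, hij, hSeq, hi, hj⟩ := exists_top_edge hlam hS hk
  have hne := ne_of_mem_edgesOfLabel hij
  have hiC : i ∉ commonNbrs G lam k i j := left_notMem_commonNbrs
  have hjC : j ∉ commonNbrs G lam k i j := right_notMem_commonNbrs
  have h1 : insert i (commonNbrs G lam k i j) ⊂ S := by
    rw [hSeq, Set.insert_comm]
    exact Set.ssubset_insert (by simp [hne.symm, hjC])
  have h2 : insert j (commonNbrs G lam k i j) ⊂ S := by
    rw [hSeq]
    exact Set.ssubset_insert (by simp [hne, hiC])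
  have h3 : (⟨_, hi⟩ : cliquePoset G lam) ≠ ⟨_, hj⟩ := by
    intro h
    have : i ∈ insert j (commonNbrs G lam k i j) := by
      rw [← Subtype.mk.inj h]
      simp
    simp [hne, hiC] at this
  have c1 := Set.ncard_insert_of_notMem hiC
  have c2 := Set.ncard_insert_of_notMem hjC
  have key : ∀ T : cliquePoset G lam, T < ⟨S, hS⟩ → T ≤ ⟨_, hi⟩ ∨ T ≤ ⟨_, hj⟩ := by
    intro T hT
    exact subset_insert_of_ssubset hlam hij T.2 (hSeq ▸ hT)
  refine ⟨i, j, hi, hj, hij, h3, Set.ext fun T => ⟨fun hT => ?_, ?_⟩⟩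
  · rcases key T hT.1 with h | h
    · exact Or.inl (h.eq_of_not_lt fun h' => hT.2 h' h1)
    · exact Or.inr (h.eq_of_not_lt fun h' => hT.2 h' h2)
  · rintro (rfl | rfl)
    · refine ⟨h1, fun X hX hXS => ?_⟩
      have hlt : _ < (X : Set V).ncard := Set.ncard_lt_ncard hX (Set.toFinite _)
      rcases key X hXS with h | h
      · exact hX.not_ge h
      · have := Set.ncard_le_ncard h (Set.toFinite _)
        simp only at this hlt
        omega
    · refine ⟨h2, fun X hX hXS => ?_⟩
      have hlt : _ < (X : Set V).ncard := Set.ncard_lt_ncard hX (Set.toFinite _)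
      rcases key X hXS with h | h
      · have := Set.ncard_le_ncard h (Set.toFinite _)
        simp only at this hlt
        omega
      · exact hX.not_ge h

/-! ### Vines and their principal ideals -/

section Posets

variable {P : Type*} [PartialOrder P] {rk : P → ℕ}

theorem IsGradedBy.mono (h : IsGradedBy P rk) {x y : P} (hxy : x ≤ y) : rk x ≤ rk y :=
  hxy.eq_or_lt.elim (fun h => h ▸ le_rfl) fun hlt => (h.strict _ _ hlt).le

theorem IsGradedBy.eq_of_le (h : IsGradedBy P rk) {x y : P} (hxy : x ≤ y) (hrk : rk x = rk y) :
    x = y :=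
  hxy.eq_of_not_lt fun hlt => (h.strict _ _ hlt).ne hrk

theorem exists_le_mem_coveredBy [Finite P] {x y : P} (hxy : x < y) : ∃ z ∈ coveredBy y, x ≤ z := by
  obtain ⟨z, hxz, hzy⟩ := exists_le_covBy_of_lt hxy
  exact ⟨z, hzy, hxz⟩

theorem IsVine.exists_coveredBy (h : IsVine P rk) {a : P} (ha : ¬ IsMin a) :
    ∃ b c, b ≠ c ∧ coveredBy a = {b, c} ∧ b ⋖ a ∧ c ⋖ a := by
  obtain ⟨b, c, hbc, heq⟩ := Set.ncard_eq_two.1 (h.covers_two a ha)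
  have hb : b ∈ coveredBy a := heq ▸ Set.mem_insert b {c}
  have hc : c ∈ coveredBy a := heq ▸ Set.mem_insert_of_mem b rfl
  exact ⟨b, c, hbc, heq, hb, hc⟩

theorem IsVine.exists_le_of_rank (h : IsVine P rk) {r : ℕ} (hr : 1 ≤ r) (a : P) (ha : r ≤ rk a) :
    ∃ x ≤ a, rk x = r := by
  induction hn : rk a generalizing a with
  | zero => omega
  | succ n ih =>
    rcases ha.eq_or_lt with ha | ha
    · exact ⟨a, le_rfl, ha.symm⟩
    have hmin : ¬ IsMin a := fun hm => by have := h.graded.minimal a hm; omega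
    obtain ⟨b, -, -, -, hba, -⟩ := h.exists_coveredBy hmin
    have hb := h.graded.cover _ _ hba
    obtain ⟨x, hx, hxr⟩ := ih b (by omega) (by omega)
    exact ⟨x, hx.trans hba.le, hxr⟩

/-- Elements of the same rank below a common element are connected in the associated graph. -/
theorem IsVine.reachable_of_le (h : IsVine P rk)
    (hprox : ∀ i : ℕ, 2 ≤ i → ∀ a b : P, a ≠ b → rk a = i → rk b = i →
      (∃ v : P, a ⋖ v ∧ b ⋖ v) → ∃ u : P, u ⋖ a ∧ u ⋖ b)
    {r : ℕ} (hr : 1 ≤ r) (a : P) (x y : {x : P // rk x = r}) (hx : x.1 ≤ a) (hy : y.1 ≤ a) :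
    (associatedGraph rk r).Reachable x y := by
  have := h.finite
  induction hn : rk a generalizing a x y with
  | zero => have := h.graded.mono hx; have := x.2; omega
  | succ n ih =>
    have hxr := x.2
    have hyr := y.2
    by_cases hra : rk a = r
    · have hxa := h.graded.eq_of_le hx (hxr.trans hra.symm)
      have hya := h.graded.eq_of_le hy (hyr.trans hra.symm)
      rw [Subtype.ext (hxa.trans hya.symm)]
    have hxa : x.1 < a := hx.lt_of_ne fun h => hra (h ▸ hxr)
    have hya : y.1 < a := hy.lt_of_ne fun h => hra (h ▸ hyr)
    obtain ⟨b, c, hbc, heq, hba, hca⟩ := h.exists_coveredBy (not_isMin_of_lt hxa)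
    have hb := h.graded.cover _ _ hba
    have hc := h.graded.cover _ _ hca
    -- Passing between the two elements covered by `a`: at rank `r` they are adjacent through `a`
    -- itself; at higher rank, proximity supplies a common lower cover `u`, and any rank-`r` element
    -- below `u` serves as a bridge between the two inductive connections.
    have hlink : ∀ x y : {x : P // rk x = r}, x.1 ≤ b → y.1 ≤ c →
        (associatedGraph rk r).Reachable x y := by
      intro x y hx hy
      have hxr := x.2
      have hyr := y.2
      have h1 := h.graded.mono hx
      by_cases hrb : rk b = r
      · have hxb := h.graded.eq_of_le hx (by omega)
        have hyc := h.graded.eq_of_le hy (by omega)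
        refine SimpleGraph.Adj.reachable ⟨fun hxy => hbc ?_, a, by omega, ?_⟩
        · rw [← hxb, ← hyc, hxy]
        · rw [heq, hxb, hyc]
      · obtain ⟨u, hub, huc⟩ := hprox (rk b) (by omega) b c hbc rfl (by omega) ⟨a, hba, hca⟩
        have := h.graded.cover _ _ hub
        obtain ⟨z, hzu, hz⟩ := h.exists_le_of_rank hr u (by omega)
        exact (ih b x ⟨z, hz⟩ hx (hzu.trans hub.le) (by omega)).trans
          (ih c ⟨z, hz⟩ y (hzu.trans huc.le) hy (by omega))
    obtain ⟨x', hx', hxx'⟩ := exists_le_mem_coveredBy hxa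
    obtain ⟨y', hy', hyy'⟩ := exists_le_mem_coveredBy hya
    rw [heq] at hx' hy'
    rcases hx' with rfl | rfl <;> rcases hy' with rfl | rfl
    · exact ih _ x y hxx' hyy' (by omega)
    · exact hlink x y hxx' hyy'
    · exact (hlink y x hyy' hxx').symm
    · exact ih _ x y hxx' hyy' (by omega)

theorem IsGradedBy.posetRank_eq (h : IsGradedBy P rk) {t : P} (ht : ∀ x, x ≤ t) :
    posetRank rk = rk t := by
  have : Nonempty P := ⟨t⟩
  exact le_antisymm (ciSup_le fun x => h.mono (ht x))
    (le_ciSup (f := rk) ⟨rk t, by rintro _ ⟨x, rfl⟩; exact h.mono (ht x)⟩ t)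

/-- A vine with a greatest element, satisfying the proximity condition, and of the right dimension
is regular. -/
theorem IsVine.isRVine (h : IsVine P rk)
    (hprox : ∀ i : ℕ, 2 ≤ i → ∀ a b : P, a ≠ b → rk a = i → rk b = i →
      (∃ v : P, a ⋖ v ∧ b ⋖ v) → ∃ u : P, u ⋖ a ∧ u ⋖ b)
    {t : P} (ht : ∀ x, x ≤ t) (hdim : posetDim P = rk t) : IsRVine P rk where
  vine := h
  rank_eq_dim := (h.graded.posetRank_eq ht).trans hdim.symm
  tree i hi hit := by
    rw [h.graded.posetRank_eq ht] at hit
    obtain ⟨x, -, hx⟩ := h.exists_le_of_rank hi t hit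
    have : Nonempty {x : P // rk x = i} := ⟨⟨x, hx⟩⟩
    exact ⟨⟨fun x y => h.reachable_of_le hprox hi t x y (ht _) (ht _)⟩,
      h.forest i hi (by rwa [h.graded.posetRank_eq ht])⟩
  proximity := hprox

theorem covBy_Iic_iff {a : P} {x y : Set.Iic a} : x ⋖ y ↔ x.1 ⋖ y.1 := by
  refine (Set.OrdConnected.apply_covBy_apply_iff (OrderEmbedding.subtype fun c => c ≤ a) ?_).symm
  simpa only [OrderEmbedding.coe_subtype, Subtype.range_coe_subtype] using! Set.ordConnected_Iic

theorem isMin_Iic_iff {a : P} {x : Set.Iic a} : IsMin x ↔ IsMin x.1 :=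
  ⟨fun h y hy => h (b := ⟨y, hy.trans x.2⟩) hy, fun h _ hy => h hy⟩

theorem image_coveredBy_Iic {a : P} (v : Set.Iic a) :
    Subtype.val '' coveredBy v = coveredBy v.1 := by
  ext x
  constructor
  · rintro ⟨y, hy, rfl⟩
    exact covBy_Iic_iff.1 hy
  · exact fun hx => ⟨⟨x, hx.le.trans v.2⟩, covBy_Iic_iff.2 hx, rfl⟩

/-- A principal ideal is a lower set, so covers, minimality and the sets `coveredBy` agree with
those of `P`; its associated graphs embed in those of `P` and inherit acyclicity. -/
theorem IsVine.Iic (h : IsVine P rk) (a : P) : IsVine (Set.Iic a) fun x => rk x.1 where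
  finite := have := h.finite; inferInstance
  graded :=
    { strict := fun x y hxy => h.graded.strict _ _ hxy
      cover := fun x y hxy => h.graded.cover _ _ (covBy_Iic_iff.1 hxy)
      minimal := fun x hx => h.graded.minimal _ (isMin_Iic_iff.1 hx) }
  covers_two v hv := by
    rw [← Set.ncard_image_of_injective _ Subtype.val_injective, image_coveredBy_Iic]
    exact h.covers_two _ fun hm => hv (isMin_Iic_iff.2 hm)
  covered_unique x y hxy hrk v w hxv hyv hxw hyw :=
    Subtype.ext (h.covered_unique x y (fun h => hxy (Subtype.ext h)) hrk v w (covBy_Iic_iff.1 hxv)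
      (covBy_Iic_iff.1 hyv) (covBy_Iic_iff.1 hxw) (covBy_Iic_iff.1 hyw))
  forest i hi hi' := by
    have := h.finite
    have hle : i ≤ posetRank rk := hi'.trans <|
      have : Nonempty (Set.Iic a) := ⟨⟨a, le_rfl⟩⟩
      ciSup_le fun x => le_ciSup (f := rk) (Set.finite_range rk).bddAbove x.1
    let f : associatedGraph (fun x : Set.Iic a => rk x.1) i →g associatedGraph rk i :=
      { toFun := fun x => ⟨x.1.1, x.2⟩
        map_rel' := by
          rintro x y ⟨hne, v, hv, hcov⟩
          refine ⟨fun hxy => hne (Subtype.ext (Subtype.ext (Subtype.mk.inj hxy))), v, hv, ?_⟩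
          rw [← image_coveredBy_Iic, hcov, Set.image_pair] }
    exact (h.forest i hi hle).comap f fun x y hxy =>
      Subtype.ext (Subtype.ext (congrArg (fun z : {x : P // rk x = i} => z.1) hxy))

end Posets

/-! ### The clique poset is a vine -/

theorem cliqueRank_pos [Finite V] (S : cliquePoset G lam) : 0 < cliqueRank G lam S :=
  (Set.ncard_pos (Set.toFinite _)).2 (nonempty_of_mem_cliquePoset S.2)

theorem isMin_iff_cliqueRank_eq_one [Finite V] {S : cliquePoset G lam} :
    IsMin S ↔ cliqueRank G lam S = 1 := by
  constructor
  · intro h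
    obtain ⟨v, hv⟩ := nonempty_of_mem_cliquePoset S.2
    have hle : (⟨{v}, singleton_mem_cliquePoset v⟩ : cliquePoset G lam) ≤ S :=
      Set.singleton_subset_iff.2 hv
    rw [← h.eq_of_le hle]
    exact Set.ncard_singleton v
  · intro h T hT
    exact (Set.eq_of_subset_of_ncard_le (s := (T : Set V)) (t := S) hT
      (h.le.trans (cliqueRank_pos T)) (Set.toFinite _)).ge

theorem exists_coveredBy_eq [Finite V] (hlam : IsMATLabeling G lam) {S : cliquePoset G lam} {r : ℕ}
    (hr : 1 ≤ r) (hS : cliqueRank G lam S = r + 1) :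
    ∃ k : ℕ+, (k : ℕ) = r ∧ ∃ i j, ∃ hi : insert i (commonNbrs G lam k i j) ∈ cliquePoset G lam,
      ∃ hj : insert j (commonNbrs G lam k i j) ∈ cliquePoset G lam,
      s(i, j) ∈ edgesOfLabel G lam k ∧ (⟨_, hi⟩ : cliquePoset G lam) ≠ ⟨_, hj⟩ ∧
      coveredBy S = {⟨_, hi⟩, ⟨_, hj⟩} :=
  ⟨⟨r, hr⟩, rfl, coveredBy_eq hlam hS⟩

theorem exists_of_not_isMin [Finite V] {S : cliquePoset G lam} (hS : ¬ IsMin S) :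
    ∃ r, 1 ≤ r ∧ cliqueRank G lam S = r + 1 := by
  have h1 := cliqueRank_pos S
  have h2 := mt isMin_iff_cliqueRank_eq_one.2 hS
  exact ⟨cliqueRank G lam S - 1, by omega, by omega⟩

theorem isGradedBy_cliqueRank [Finite V] (hlam : IsMATLabeling G lam) :
    IsGradedBy (cliquePoset G lam) (cliqueRank G lam) where
  strict _ _ hxy := Set.ncard_lt_ncard hxy (Set.toFinite _)
  cover x y hxy := by
    obtain ⟨r, hr, hy⟩ := exists_of_not_isMin (not_isMin_of_lt hxy.lt)
    obtain ⟨k, rfl, i, j, hi, hj, hij, -, heq⟩ := exists_coveredBy_eq hlam hr hy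
    have hcard := ncard_commonNbrs hlam hij
    have hx : x ∈ coveredBy y := hxy
    rw [hy]
    rw [heq] at hx
    rcases hx with rfl | rfl
    · exact congrArg (· + 1) ((Set.ncard_insert_of_notMem left_notMem_commonNbrs).trans hcard).symm
    · exact congrArg (· + 1) ((Set.ncard_insert_of_notMem right_notMem_commonNbrs).trans hcard).symm
  minimal _ hx := isMin_iff_cliqueRank_eq_one.1 hx

/-- Since `A` and `B` are distinct of size `|S| - 1`, their union already has size `|S|`. Hence two
nodes determine any node covering both. -/
theorem coe_eq_union_of_covBy [Finite V] (hlam : IsMATLabeling G lam) {A B S : cliquePoset G lam}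
    (hne : A ≠ B) (hA : A ⋖ S) (hB : B ⋖ S) : (S : Set V) = A.1 ∪ B.1 := by
  have h1 : cliqueRank G lam S = cliqueRank G lam A + 1 := (isGradedBy_cliqueRank hlam).cover A S hA
  have h2 : cliqueRank G lam S = cliqueRank G lam B + 1 := (isGradedBy_cliqueRank hlam).cover B S hB
  refine (Set.eq_of_subset_of_ncard_le (Set.union_subset hA.le hB.le) ?_ (Set.toFinite _)).symm
  have hss : A.1 ⊂ A.1 ∪ B.1 := by
    refine Set.subset_union_left.ssubset_of_ne fun h => hne ?_
    have hBA : (B : Set V) ⊆ A := h ▸ Set.subset_union_right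
    exact Subtype.ext (Set.eq_of_subset_of_ncard_le hBA
      (by unfold cliqueRank at h1 h2; omega) (Set.toFinite _)).symm
  have := Set.ncard_lt_ncard hss (Set.toFinite _)
  unfold cliqueRank at h1
  omega

theorem exists_of_associatedGraph_adj [Finite V] (hlam : IsMATLabeling G lam) {k : ℕ+}
    {X Y : {x // cliqueRank G lam x = k}} (h : (associatedGraph (cliqueRank G lam) k).Adj X Y) :
    ∃ a b, s(a, b) ∈ edgesOfLabel G lam k ∧ (X.1 : Set V) = insert a (commonNbrs G lam k a b) ∧
      (Y.1 : Set V) = insert b (commonNbrs G lam k a b) := by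
  obtain ⟨hne, v, hv, hcov⟩ := h
  obtain ⟨i, j, hi, hj, hij, hne', heq⟩ := coveredBy_eq hlam hv
  rw [hcov, Set.pair_eq_pair_iff] at heq
  rcases heq with ⟨h1, h2⟩ | ⟨h1, h2⟩
  · exact ⟨i, j, hij, congrArg Subtype.val h1, congrArg Subtype.val h2⟩
  · exact ⟨j, i, by rwa [Sym2.eq_swap], by rw [commonNbrs_comm]; exact congrArg Subtype.val h1,
      by rw [commonNbrs_comm]; exact congrArg Subtype.val h2⟩

/-- Every edge `AB` of `F_k` is a bridge: it comes from a label-`k` edge `ij` with conditioning set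
`C`, and a walk from `A` to `B` avoiding it would project to a connection from `i` to `j` outside
`C`, against `separatesAt`. -/
theorem associatedGraph_isAcyclic [Finite V] (hlam : IsMATLabeling G lam) (k : ℕ+) :
    (associatedGraph (cliqueRank G lam) k).IsAcyclic := by
  rw [SimpleGraph.isAcyclic_iff_forall_adj_isBridge]
  intro A B hAB
  rw [SimpleGraph.isBridge_iff]
  obtain ⟨i, j, hij, hA, hB⟩ := exists_of_associatedGraph_adj hlam hAB
  set C := commonNbrs G lam k i j
  have hiC : i ∉ C := left_notMem_commonNbrs
  have hjC : j ∉ C := right_notMem_commonNbrs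
  have hcard : C.ncard + 1 = k := ncard_commonNbrs hlam hij
  have key : ∀ X, ((associatedGraph (cliqueRank G lam) k).deleteEdges {s(A, B)}).Reachable A X →
      ∀ x ∈ (X.1 : Set V), x ∉ C →
        (graphAvoiding (edgesOfLabelLE G lam k \ {s(i, j)}) C).Reachable i x := by
    intro X hX
    rw [SimpleGraph.reachable_iff_reflTransGen] at hX
    induction hX with
    | refl =>
      intro x hx hxC
      rw [hA] at hx
      rw [hx.resolve_right hxC]
    | @tail X Y _ hXY ih =>
      intro y hy hyC
      rw [SimpleGraph.deleteEdges_adj] at hXY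
      obtain ⟨a, b, hab, hXa, hYb⟩ := exists_of_associatedGraph_adj hlam hXY.1
      have hYlt := pairwise_of_mem_cliquePoset hlam Y.1.2 Y.2
      -- If the step from `X` to `Y` also has conditioning set `C`, it projects to the edge `ab`,
      -- which differs from `ij` because the step is not `AB`. Otherwise `X` and `Y` share a vertex
      -- `d` outside `C`, already connected to `i`, and the clique `Y` joins `d` to its other
      -- vertices by labels below `k`.
      by_cases hsub : commonNbrs G lam k a b ⊆ C
      · have heq : commonNbrs G lam k a b = C := by
          refine Set.eq_of_subset_of_ncard_le hsub ?_ (Set.toFinite _)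
          have := ncard_commonNbrs hlam hab
          omega
        have haC : a ∉ C := heq ▸ left_notMem_commonNbrs
        have hbC : b ∉ C := heq ▸ right_notMem_commonNbrs
        rw [heq] at hXa hYb
        rw [hYb] at hy
        obtain rfl : y = b := hy.resolve_right hyC
        refine (ih a (by simp [hXa]) haC).trans (SimpleGraph.Adj.reachable (graphAvoiding_adj.2
          ⟨⟨edgesOfLabel_subset_LE hab, fun h => hXY.2 ?_⟩, haC, hbC, ne_of_mem_edgesOfLabel hab⟩))
        rcases Sym2.eq_iff.1 h with ⟨rfl, rfl⟩ | ⟨rfl, rfl⟩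
        · rw [Subtype.ext (Subtype.ext (hXa.trans hA.symm)),
            Subtype.ext (Subtype.ext (hYb.trans hB.symm))]
          rfl
        · rw [Subtype.ext (Subtype.ext (hXa.trans hB.symm)),
            Subtype.ext (Subtype.ext (hYb.trans hA.symm))]
          exact Sym2.eq_swap
      · obtain ⟨d, hd, hdC⟩ := Set.not_subset.1 hsub
        have hid := ih d (by rw [hXa]; exact Or.inr hd) hdC
        by_cases hdy : d = y
        · exact hdy ▸ hid
        have hlt := hYlt (by rw [hYb]; exact Or.inr hd) hy hdy
        refine hid.trans (SimpleGraph.Adj.reachable (graphAvoiding_adj.2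
          ⟨⟨edgesOfLabelLT_subset_LE hlt, fun h => ?_⟩, hdC, hyC, hdy⟩))
        exact notMem_edgesOfLabel_of_LT hlt (Set.mem_singleton_iff.1 h ▸ hij)
  exact fun h => separatesAt hlam k i j hij (key B h j (by simp [hB]) hjC)

theorem isVine_cliquePoset [Finite V] (hlam : IsMATLabeling G lam) :
    IsVine (cliquePoset G lam) (cliqueRank G lam) where
  finite := inferInstance
  graded := isGradedBy_cliqueRank hlam
  covers_two v hv := by
    obtain ⟨r, hr, hv⟩ := exists_of_not_isMin hv
    obtain ⟨k, rfl, i, j, hi, hj, hij, hne, heq⟩ := exists_coveredBy_eq hlam hr hv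
    rw [heq, Set.ncard_pair hne]
  covered_unique a b hab _ v w hav hbv haw hbw :=
    Subtype.ext ((coe_eq_union_of_covBy hlam hab hav hbv).trans
      (coe_eq_union_of_covBy hlam hab haw hbw).symm)
  forest i hi _ := associatedGraph_isAcyclic hlam ⟨i, hi⟩

theorem cliquePoset_proximity [Finite V] (hlam : IsMATLabeling G lam) {a b v : cliquePoset G lam}
    (hab : a ≠ b) (ha : 2 ≤ cliqueRank G lam a) (hav : a ⋖ v) (hbv : b ⋖ v) :
    ∃ u, u ⋖ a ∧ u ⋖ b := by
  have hv : cliqueRank G lam v = cliqueRank G lam a + 1 := (isGradedBy_cliqueRank hlam).cover a v hav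
  obtain ⟨k, hk, i, j, hi, hj, hij, hne, heq⟩ := exists_coveredBy_eq hlam (by omega) hv
  have hu := commonNbrs_mem_cliquePoset hlam hij (by rw [← PNat.coe_lt_coe]; simp; omega)
  have h1 : (⟨_, hu⟩ : cliquePoset G lam) ⋖ ⟨_, hi⟩ :=
    ⟨Set.ssubset_insert left_notMem_commonNbrs, fun X hX hX' =>
      (Set.covBy_insert left_notMem_commonNbrs).2 (c := (X : Set V)) hX hX'⟩
  have h2 : (⟨_, hu⟩ : cliquePoset G lam) ⋖ ⟨_, hj⟩ :=
    ⟨Set.ssubset_insert right_notMem_commonNbrs, fun X hX hX' =>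
      (Set.covBy_insert right_notMem_commonNbrs).2 (c := (X : Set V)) hX hX'⟩
  have ha : a ∈ coveredBy v := hav
  have hb : b ∈ coveredBy v := hbv
  rw [heq] at ha hb
  rcases ha with rfl | rfl <;> rcases hb with rfl | rfl
  · exact absurd rfl hab
  · exact ⟨_, h1, h2⟩
  · exact ⟨_, h2, h1⟩
  · exact absurd rfl hab

theorem exists_eq_singleton_of_isMin [Finite V] {S : cliquePoset G lam} (hS : IsMin S) :
    ∃ v, S = ⟨{v}, singleton_mem_cliquePoset v⟩ := by
  obtain ⟨v, hv⟩ := Set.ncard_eq_one.1 (isMin_iff_cliqueRank_eq_one.1 hS)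
  exact ⟨v, Subtype.ext hv⟩

theorem isMin_singleton [Finite V] (v : V) :
    IsMin (⟨{v}, singleton_mem_cliquePoset v⟩ : cliquePoset G lam) :=
  isMin_iff_cliqueRank_eq_one.2 (Set.ncard_singleton v)

theorem posetDim_Iic [Finite V] (a : cliquePoset G lam) :
    posetDim (Set.Iic a) = cliqueRank G lam a := by
  refine (Set.ncard_congr (s := (a : Set V))
    (fun v hv => ⟨⟨{v}, singleton_mem_cliquePoset v⟩, Set.singleton_subset_iff.2 hv⟩)
    (fun v _ => isMin_Iic_iff.2 (isMin_singleton v)) ?_ ?_).symm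
  · intro v w _ _ h
    exact Set.singleton_injective (congrArg (fun x : Set.Iic a => (x.1 : Set V)) h)
  · rintro ⟨S, hSa⟩ hS
    obtain ⟨v, rfl⟩ := exists_eq_singleton_of_isMin (isMin_Iic_iff.1 hS)
    exact ⟨v, hSa (Set.mem_singleton v), rfl⟩

theorem posetDim_cliquePoset [Finite V] : posetDim (cliquePoset G lam) = Nat.card V := by
  rw [← Set.ncard_univ]
  refine (Set.ncard_congr (fun v _ => ⟨{v}, singleton_mem_cliquePoset v⟩)
    (fun v _ => isMin_singleton v) ?_ ?_).symm
  · intro v w _ _ h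
    exact Set.singleton_injective (congrArg Subtype.val h)
  · intro S hS
    obtain ⟨v, rfl⟩ := exists_eq_singleton_of_isMin hS
    exact ⟨v, trivial, rfl⟩

theorem isLRVine_cliquePoset [Finite V] (hlam : IsMATLabeling G lam) :
    IsLRVine (cliquePoset G lam) (cliqueRank G lam) where
  vine := isVine_cliquePoset hlam
  locally_regular a := by
    refine ((isVine_cliquePoset hlam).Iic a).isRVine ?_ (t := ⟨a, le_refl a⟩) (fun x => x.2)
      (posetDim_Iic a)
    rintro i hi x y hxy hx hy ⟨v, hxv, hyv⟩
    obtain ⟨u, hux, huy⟩ := cliquePoset_proximity hlam (fun h => hxy (Subtype.ext h))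
      (hi.trans hx.ge) (covBy_Iic_iff.1 hxv) (covBy_Iic_iff.1 hyv)
    exact ⟨⟨u, hux.le.trans x.2⟩, covBy_Iic_iff.2 hux, covBy_Iic_iff.2 huy⟩

/-- For a complete graph, the whole vertex set belongs to the poset. -/
theorem univ_mem_cliquePoset [Finite V] [Nonempty V] (hlam : IsMATLabeling G lam) (hG : G = ⊤) :
    Set.univ ∈ cliquePoset G lam := by
  cases subsingleton_or_nontrivial V with
  | inl h =>
    obtain ⟨v⟩ := ‹Nonempty V›
    rw [← Set.eq_univ_of_forall (s := {v}) fun w => Subsingleton.elim w v]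
    exact singleton_mem_cliquePoset v
  | inr h =>
    obtain ⟨k, hk⟩ := (Set.finite_range lam).bddAbove
    -- With `k` an upper bound for all labels, `k + 1` is a strict one. The principal clique of an
    -- edge of globally largest label is then the whole vertex set.
    obtain ⟨l, -, a, -, b, -, hab, hle⟩ := exists_max_label (G := G) (lam := lam) (k := k + 1)
      Set.nontrivial_univ fun a _ b _ hne =>
        ⟨by simpa [hG] using hne, PNat.lt_add_one_iff.2 (hk ⟨_, rfl⟩)⟩
    refine Or.inr ⟨⟨s(a, b), hab.1⟩, ?_⟩
    rw [principalClique_eq hab.1 hab.2]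
    refine (Set.eq_univ_of_forall fun d => ?_).symm
    by_cases hda : d = a
    · simp [hda]
    by_cases hdb : d = b
    · simp [hdb]
    exact Or.inr (Or.inr (mem_commonNbrs_of_LE hlam hab (hle trivial trivial (Ne.symm hda))
      (hle trivial trivial (Ne.symm hdb))))

theorem isRVine_cliquePoset_of_eq_top [Finite V] (hlam : IsMATLabeling G lam) (hG : G = ⊤) :
    IsRVine (cliquePoset G lam) (cliqueRank G lam) := by
  have hprox : ∀ i : ℕ, 2 ≤ i → ∀ a b : cliquePoset G lam, a ≠ b → cliqueRank G lam a = i →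
      cliqueRank G lam b = i → (∃ v, a ⋖ v ∧ b ⋖ v) → ∃ u, u ⋖ a ∧ u ⋖ b :=
    fun i hi a b hab ha _ ⟨v, hav, hbv⟩ => cliquePoset_proximity hlam hab (hi.trans ha.ge) hav hbv
  cases isEmpty_or_nonempty V with
  | inl h =>
    have : IsEmpty (cliquePoset G lam) :=
      ⟨fun S => (nonempty_of_mem_cliquePoset S.2).elim fun v _ => isEmptyElim v⟩
    -- The supremum over the empty poset is `0` in `ℕ`, so the tree condition is vacuous.
    have hrank : posetRank (cliqueRank G lam) = 0 := by simp [posetRank]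
    exact ⟨isVine_cliquePoset hlam, by rw [hrank, posetDim_cliquePoset, Nat.card_of_isEmpty],
      fun i hi hi' => by omega, hprox⟩
  | inr h =>
    refine (isVine_cliquePoset hlam).isRVine hprox (t := ⟨_, univ_mem_cliquePoset hlam hG⟩)
      (fun S => Set.subset_univ _) ?_
    rw [posetDim_cliquePoset, cliqueRank, Set.ncard_univ]

end MATVine

theorem mainTheorem4 {V : Type*} [Finite V] (G : SimpleGraph V) (lam : G.edgeSet → ℕ+)
    (hlam : MATVine.IsMATLabeling G lam) :
    MATVine.IsLRVine (MATVine.cliquePoset G lam) (MATVine.cliqueRank G lam) ∧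
      (G = ⊤ → MATVine.IsRVine (MATVine.cliquePoset G lam) (MATVine.cliqueRank G lam)) :=
  ⟨MATVine.isLRVine_cliquePoset hlam, MATVine.isRVine_cliquePoset_of_eq_top hlam⟩
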